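/- For real $b>1$ and real $x$ let $$I(b,x)=\frac1{2\pi}\int_0^{2\pi}\exp\bigl(-ix\arg(1-b^{-1}e^{i\theta})\bigr)\,d\theta ,$$ where $\arg$ is the principal argument. There is exactly one sequence of real polynomials $Q_1,Q_2,\dots$ such that, for all real $x$ and all real $b>\max(1,|x|)$, one has $I(b,2x)\neq 0$ and $$\log I(b,2x)=-\sum_{n=1}^{\infty}\frac{Q_n(x)}{n!^2}\,\frac1{b^{2n}} .$$ Let $q_{n,n}$ denote the coefficient of $x^{2n}$ in $Q_n(x)$. Let $J_0(z)=\sum_{m\ge0}\frac{(-1)^m}{m!^2}\left(\frac z2\right)^{2m}$ be the Bessel function of order zero; its positive zeros form an infinite sequence $j_{0,1}<j_{0,2}<\cdots$. Then, for every integer $n\ge1$, the series below converges and $$q_{n,n}=2^{2n}\,n!\,(n-1)!\sum_{k=1}^{\infty}\frac1{j_{0,k}^{2n}} .$$ -/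

import Mathlib

noncomputable section

/-- The function `I(b, x) = (1 / 2π) ∫₀^{2π} exp (-i x arg (1 - b⁻¹ e^{iθ})) dθ`, where `arg` is the
principal argument; for `b > 1` the number `1 - b⁻¹ e^{iθ}` lies in the right half-plane. -/
def charI (b x : ℝ) : ℂ :=
  1 / (2 * (Real.pi : ℂ)) * ∫ θ in (0 : ℝ)..(2 * Real.pi),
    Complex.exp (-(Complex.I * (x : ℂ) *
      (Complex.arg (1 - (b : ℂ)⁻¹ * Complex.exp (Complex.I * (θ : ℂ))) : ℂ)))

/-- The sequence of polynomials `Q₁, Q₂, …` satisfies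
`log I(b, 2x) = - ∑_{n ≥ 1} Q_n(x) / (n!² b^{2n})` for all real `x` and `b > max(1, |x|)`. -/
def IsLogExpansion (Q : ℕ+ → Polynomial ℝ) : Prop :=
  ∀ b x : ℝ, max 1 |x| < b → charI b (2 * x) ≠ 0 ∧
    HasSum (fun n : ℕ+ =>
        -(((Q n).eval x / ((Nat.factorial n : ℝ) ^ 2 * b ^ (2 * (n : ℕ))) : ℝ) : ℂ))
      (Complex.log (charI b (2 * x)))

/-- The Bessel function `J₀(z) = ∑_m (-1)^m / (m!)² (z / 2)^{2m}`. -/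
def besselJZero (z : ℂ) : ℂ :=
  ∑' m : ℕ, (-1) ^ m / (Nat.factorial m : ℂ) ^ 2 * (z / 2) ^ (2 * m)

/-- `j 0 < j 1 < j 2 < …` is the increasing enumeration of all positive zeros of `J₀`; the usual
`j_{0,k}` for `k ≥ 1` is `j (k - 1)`. -/
def IsBesselZeroSeq (j : ℕ → ℝ) : Prop :=
  StrictMono j ∧ Set.range j = {x : ℝ | 0 < x ∧ besselJZero (x : ℂ) = 0}

end

/-! With w = 1 - e^{iθ}/b, exp(-2ix arg w) = w^{-x} · conj(w)^x. Expanding both binomial series and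
integrating over θ keeps only the diagonal, so I(b, 2x) = F(t) := ∑ C(-x, n) C(x, n) tⁿ = ₂F₁(x, -x;
1; t) at t = b⁻² (`hasSum_charI`). Since (t d/dt)² F = -x² t/(1 - t) · F, the logarithmic derivative
p = t F'/F solves the Riccati equation t p' = -x² t/(1 - t) - p². Its coefficients pₙ are
polynomials in x, and log F = ∑ pₙ tⁿ/n forces Q_n = -n! (n - 1)! pₙ (`isLogExpansion_iff`).

Each pₙ has degree at most 2n, and its x^{2n} coefficients satisfy the same recursion with
right-hand side -t (`natDegree_coeff_logPoly`). That is the Riccati equation of s G'/G for G(s) = ∑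
(-s)ᵏ/k!², where J₀(z) = G(z²/4) and (s d/ds)² G = -s G.

Finally G(s) = ∏ (1 - s aₖ) with aₖ = 4/j_{0,k}², so s G'/G = -∑ₙ (∑ₖ aₖⁿ) sⁿ
(`riccatiCoeff_besselRiccati`), which gives the formula. The product is obtained as a limit of the
Laguerre polynomials L_n(s/n), whose zeros are real and positive (`exists_besselSeries_eq_tprod`);
simplicity of the zeros of G then makes the aₖ distinct (`strictAnti_of_besselSeries_eq_tprod`). -/

open Finset Filter Topology

/-! ### The Riccati recursion and formal power series -/

/-- The coefficients of the power series solution `p = ∑ pₙ tⁿ`, `p₀ = 0`, of the Riccati equation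
`t p' = d - p²`. -/
noncomputable def riccatiCoeff {A : Type*} [CommRing A] [Algebra ℝ A] (d : ℕ → A) : ℕ → A
  | 0 => 0
  | n + 1 => ((n + 1 : ℝ)⁻¹) •
      (d (n + 1) - ∑ i : Fin n, riccatiCoeff d (i + 1) * riccatiCoeff d (n - i))
termination_by n => n
decreasing_by all_goals omega

@[simp]
theorem riccatiCoeff_zero {A : Type*} [CommRing A] [Algebra ℝ A] (d : ℕ → A) :
    riccatiCoeff d 0 = 0 := by
  rw [riccatiCoeff]

theorem riccatiCoeff_succ {A : Type*} [CommRing A] [Algebra ℝ A] (d : ℕ → A) (n : ℕ) :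
    riccatiCoeff d (n + 1) = ((n + 1 : ℝ)⁻¹) • (d (n + 1) -
      ∑ i ∈ range n, riccatiCoeff d (i + 1) * riccatiCoeff d (n - i)) := by
  rw [riccatiCoeff, Finset.sum_range]

theorem riccatiCoeff_map {A B : Type*} [CommRing A] [Algebra ℝ A] [CommRing B] [Algebra ℝ B]
    (φ : A →ₐ[ℝ] B) (d : ℕ → A) (n : ℕ) :
    φ (riccatiCoeff d n) = riccatiCoeff (fun k => φ (d k)) n := by
  induction n using Nat.strong_induction_on with
  | _ n ih =>
    cases n with
    | zero => simp
    | succ n =>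
      rw [riccatiCoeff_succ, riccatiCoeff_succ, map_smul, map_sub, map_sum]
      congr 2
      refine Finset.sum_congr rfl fun i hi => ?_
      have := mem_range.1 hi
      rw [map_mul, ih _ (by omega), ih _ (by omega)]

theorem natCast_mul_riccatiCoeff (d : ℕ → ℝ) (hd : d 0 = 0) (n : ℕ) :
    n * riccatiCoeff d n =
      d n - ∑ ij ∈ antidiagonal n, riccatiCoeff d ij.1 * riccatiCoeff d ij.2 := by
  cases n with
  | zero => simp [hd]
  | succ n =>
    rw [Finset.Nat.sum_antidiagonal_succ, Finset.Nat.sum_antidiagonal_eq_sum_range_succ_mk,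
      sum_range_succ]
    simp only [riccatiCoeff_zero, zero_mul, Nat.sub_self, mul_zero, add_zero, zero_add]
    conv_lhs => rw [riccatiCoeff_succ]
    have : (n + 1 : ℝ) ≠ 0 := by positivity
    rw [smul_eq_mul]
    push_cast
    field_simp

/-- The bracket in the recursion has n + 1 terms, each at most m^(n+1); the factor 1/(n + 1) absorbs
their number. -/
theorem abs_riccatiCoeff_le {d : ℕ → ℝ} {m : ℝ} (hm : 0 ≤ m) (hd : ∀ n, |d n| ≤ m ^ n) (n : ℕ) :
    |riccatiCoeff d n| ≤ m ^ n := by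
  induction n using Nat.strong_induction_on with
  | _ n ih =>
    cases n with
    | zero => simp
    | succ n =>
      have h1 : |∑ i ∈ range n, riccatiCoeff d (i + 1) * riccatiCoeff d (n - i)|
          ≤ n * m ^ (n + 1) := by
        refine (abs_sum_le_sum_abs _ _).trans ?_
        have : ∀ i ∈ range n, |riccatiCoeff d (i + 1) * riccatiCoeff d (n - i)| ≤ m ^ (n + 1) := by
          intro i hi
          have := mem_range.1 hi
          rw [abs_mul, show n + 1 = (i + 1) + (n - i) by omega, pow_add]
          exact mul_le_mul (ih _ (by omega)) (ih _ (by omega)) (abs_nonneg _) (by positivity)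
        simpa using Finset.sum_le_sum this
      rw [riccatiCoeff_succ, smul_eq_mul, abs_mul, abs_of_pos (by positivity),
        inv_mul_le_iff₀ (by positivity)]
      have h2 := abs_sub (d (n + 1)) (∑ i ∈ range n, riccatiCoeff d (i + 1) * riccatiCoeff d (n - i))
      linarith [hd (n + 1)]

namespace PowerSeries

theorem coeff_X_mul_derivative (F : ℝ⟦X⟧) (n : ℕ) :
    coeff n (X * d⁄dX ℝ F) = n * coeff n F := by
  cases n with
  | zero => simp
  | succ n => rw [coeff_succ_X_mul, coeff_derivative]; push_cast; ring

/-- If `t p' = d - p²` and `(t d/dt)² F = d F`, then `t F' = p F`. -/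
theorem X_mul_derivative_eq_of_riccati {F P D : ℝ⟦X⟧} (hP0 : constantCoeff P = 0)
    (hP : X * d⁄dX ℝ P = D - P ^ 2) (hF : X * d⁄dX ℝ (X * d⁄dX ℝ F) = D * F) :
    X * d⁄dX ℝ F = P * F := by
  -- The defect U satisfies t U' = -P U. As P has no constant term, this expresses n uₙ through
  -- earlier coefficients, so U = 0.
  set U := X * d⁄dX ℝ F - P * F with hU
  have hUeq : X * d⁄dX ℝ U = -(P * U) := by
    have : X * d⁄dX ℝ U = X * d⁄dX ℝ (X * d⁄dX ℝ F) - (X * d⁄dX ℝ P) * F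
        - P * (X * d⁄dX ℝ F) := by
      rw [hU, map_sub, Derivation.leibniz _ P F, smul_eq_mul, smul_eq_mul]
      ring
    rw [this, hF, hP, hU]
    ring
  have key : ∀ n, coeff n U = 0 := by
    intro n
    induction n using Nat.strong_induction_on with
    | _ n ih =>
      rcases Nat.eq_zero_or_pos n with rfl | hn
      · rw [hU, map_sub, coeff_X_mul_derivative, coeff_mul]
        simp [hP0]
      · have h := congrArg (coeff n) hUeq
        rw [coeff_X_mul_derivative, map_neg, coeff_mul, Finset.sum_eq_zero] at h
        · simpa [hn.ne'] using h
        · rintro ⟨i, j⟩ hij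
          have hij' : i + j = n := by simpa using hij
          rcases Nat.eq_zero_or_pos i with rfl | hi
          · simp [hP0]
          · rw [ih j (by omega), mul_zero]
  exact sub_eq_zero.1 (PowerSeries.ext key)

end PowerSeries

/-! ### From formal to convergent series: logarithms and uniqueness of coefficients -/

section Analytic

theorem summable_mul_pow {a : ℕ → ℝ} {m t : ℝ} (ha : ∀ n, |a n| ≤ m ^ n) (ht : m * |t| < 1)
    (hm : 0 ≤ m) : Summable fun n => ‖a n * t ^ n‖ := by
  refine Summable.of_nonneg_of_le (fun n => norm_nonneg _) (fun n => ?_)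
    (summable_geometric_of_lt_one (by positivity) ht)
  rw [Real.norm_eq_abs, abs_mul, abs_pow, mul_pow]
  exact mul_le_mul_of_nonneg_right (ha n) (by positivity)

theorem hasDerivAt_tsum_mul_pow {a : ℕ → ℝ} {m t : ℝ} (ha : ∀ n, |a n| ≤ m ^ n) (hm : 0 < m)
    (ht : m * |t| < 1) :
    HasDerivAt (fun y => ∑' n, a n * y ^ n) (∑' n : ℕ, a n * (n * t ^ (n - 1))) t := by
  obtain ⟨r, hr1, hr2⟩ := exists_between (show |t| < 1 / m by rwa [lt_div_iff₀' hm])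
  have hr0 : 0 ≤ r := (abs_nonneg t).trans hr1.le
  have hmr : m * r < 1 := by rwa [lt_div_iff₀' hm] at hr2
  have hu : Summable fun n : ℕ => m * (n * (m * r) ^ (n - 1)) := by
    have h := summable_pow_mul_geometric_of_norm_lt_one 1 (r := m * r)
      (by rwa [Real.norm_eq_abs, abs_of_nonneg (by positivity)])
    have h' : Summable fun n : ℕ => ((n + 1 : ℕ) : ℝ) * (m * r) ^ n := by
      simpa [add_mul] using h.add (summable_geometric_of_lt_one (by positivity) hmr)
    refine Summable.mul_left m ((summable_nat_add_iff 1).1 ?_)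
    simpa using h'
  refine hasDerivAt_tsum_of_isPreconnected hu (t := Metric.ball (0 : ℝ) r) (y₀ := 0)
    Metric.isOpen_ball (convex_ball _ _).isPreconnected (g := fun n y => a n * y ^ n)
    (g' := fun n y => a n * (n * y ^ (n - 1))) (fun n y _ => (hasDerivAt_pow n y).const_mul _)
    (fun n y hy => ?_) (by simpa using (abs_nonneg t).trans_lt hr1) ?_ (by simpa using hr1)
  · have hy' : |y| ≤ r := (by simpa using hy : |y| < r).le
    cases n with
    | zero => simp
    | succ n =>
      simp only [Nat.add_sub_cancel]
      rw [Real.norm_eq_abs, abs_mul, abs_mul, abs_pow, Nat.abs_cast]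
      calc |a (n + 1)| * ((n + 1 : ℕ) * |y| ^ n) ≤ m ^ (n + 1) * ((n + 1 : ℕ) * r ^ n) := by
            gcongr
            exact ha _
        _ = _ := by rw [mul_pow]; ring
  · simpa using (summable_mul_pow ha (t := 0) (by simp) hm.le).of_norm

/-- The hypothesis `hc` says (t d/dt)² f = D f for f = ∑ cₙ tⁿ, hence t f' = p f formally. With l =
∑ pₙ tⁿ/n, the function f e^{-l} has zero derivative for y > 0 and value 1 at 0. -/
theorem hasSum_exp_riccatiCoeff {d c : ℕ → ℝ} {m t : ℝ} (hm : 0 < m) (hd0 : d 0 = 0)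
    (hd : ∀ n, |d n| ≤ m ^ n) (hc0 : c 0 = 1)
    (hc : ∀ n : ℕ, (n : ℝ) ^ 2 * c n = ∑ ij ∈ antidiagonal n, d ij.1 * c ij.2)
    (ht0 : 0 ≤ t) (ht : m * t < 1) :
    (Summable fun n : ℕ => riccatiCoeff d n / n * t ^ n) ∧
      HasSum (fun n => c n * t ^ n) (Real.exp (∑' n : ℕ, riccatiCoeff d n / n * t ^ n)) := by
  set p := riccatiCoeff d with hp
  have hpb : ∀ n, |p n| ≤ m ^ n := abs_riccatiCoeff_le hm.le hd
  have hlb : ∀ n, |p n / n| ≤ m ^ n := by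
    intro n
    rcases Nat.eq_zero_or_pos n with rfl | hn
    · simp
    · rw [abs_div, Nat.abs_cast]
      exact (div_le_self (abs_nonneg _) (by exact_mod_cast hn)).trans (hpb n)
  have hcb : ∀ n, |c n| ≤ m ^ n := by
    intro n
    induction n using Nat.strong_induction_on with
    | _ n ih =>
      cases n with
      | zero => simp [hc0]
      | succ n =>
        have h := hc (n + 1)
        rw [Finset.Nat.sum_antidiagonal_succ, hd0, zero_mul, zero_add] at h
        have h1 : |∑ ij ∈ antidiagonal n, d (ij.1 + 1) * c ij.2| ≤ (n + 1) * m ^ (n + 1) := by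
          refine (abs_sum_le_sum_abs _ _).trans ?_
          have : ∀ ij ∈ antidiagonal n, |d (ij.1 + 1) * c ij.2| ≤ m ^ (n + 1) := by
            rintro ⟨i, j⟩ hij
            have hij' : i + j = n := by simpa using hij
            rw [abs_mul, show n + 1 = (i + 1) + j by omega, pow_add]
            exact mul_le_mul (hd _) (ih j (by omega)) (abs_nonneg _) (by positivity)
          simpa using Finset.sum_le_sum this
        rw [← h, abs_mul, abs_of_nonneg (by positivity)] at h1
        push_cast at h1
        have h2 : (n + 1 : ℝ) * |c (n + 1)| ≤ m ^ (n + 1) := by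
          refine le_of_mul_le_mul_left ?_ (show (0 : ℝ) < n + 1 by positivity)
          linarith
        have : (0 : ℝ) ≤ n * |c (n + 1)| := by positivity
        linarith
  have hformal : ∀ n : ℕ, n * c n = ∑ ij ∈ antidiagonal n, p ij.1 * c ij.2 := by
    have := PowerSeries.X_mul_derivative_eq_of_riccati (F := .mk c) (P := .mk p) (D := .mk d)
      (by simp [hp]) (by
        ext n
        rw [PowerSeries.coeff_X_mul_derivative, map_sub, pow_two, PowerSeries.coeff_mul]
        simpa using natCast_mul_riccatiCoeff d hd0 n) (by
        ext n
        rw [PowerSeries.coeff_X_mul_derivative, PowerSeries.coeff_X_mul_derivative,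
          PowerSeries.coeff_mul, ← mul_assoc, ← pow_two]
        simpa using hc n)
    intro n
    have h := congrArg (PowerSeries.coeff n) this
    rw [PowerSeries.coeff_X_mul_derivative, PowerSeries.coeff_mul] at h
    simpa using h
  have habs : ∀ y ∈ Set.Icc 0 t, m * |y| < 1 := fun y hy => by
    rw [abs_of_nonneg hy.1]
    exact (mul_le_mul_of_nonneg_left hy.2 hm.le).trans_lt ht
  have htt := habs t ⟨ht0, le_rfl⟩
  refine ⟨(summable_mul_pow hlb htt hm.le).of_norm, ?_⟩
  suffices h : ∑' n, c n * t ^ n = Real.exp (∑' n : ℕ, p n / n * t ^ n) by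
    rw [← h]
    exact (summable_mul_pow hcb htt hm.le).of_norm.hasSum
  set f : ℝ → ℝ := fun y => ∑' n, c n * y ^ n with hf
  set l : ℝ → ℝ := fun y => ∑' n : ℕ, p n / n * y ^ n with hl
  have hf' := fun y hy => hasDerivAt_tsum_mul_pow hcb hm (habs y hy)
  have hl' := fun y hy => hasDerivAt_tsum_mul_pow hlb hm (habs y hy)
  have hg' : ∀ y ∈ Set.Icc 0 t, 0 < y → HasDerivAt (fun y => f y * Real.exp (-l y)) 0 y := by
    intro y hy hy0
    have hode : ∑' n : ℕ, c n * (n * y ^ (n - 1)) =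
        (∑' n : ℕ, p n / n * (n * y ^ (n - 1))) * f y := by
      refine mul_left_cancel₀ hy0.ne' ?_
      have e1 : y * ∑' n : ℕ, c n * (n * y ^ (n - 1)) = ∑' n : ℕ, n * c n * y ^ n := by
        rw [← tsum_mul_left]
        refine tsum_congr fun n => ?_
        cases n with
        | zero => simp
        | succ n => simp only [Nat.add_sub_cancel]; ring
      have e2 : y * ∑' n : ℕ, p n / n * (n * y ^ (n - 1)) = ∑' n : ℕ, p n * y ^ n := by
        rw [← tsum_mul_left]
        refine tsum_congr fun n => ?_
        cases n with
        | zero => simp [hp]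
        | succ n =>
          simp only [Nat.add_sub_cancel]
          have : ((n + 1 : ℕ) : ℝ) ≠ 0 := by positivity
          field_simp
          ring
      rw [e1, ← mul_assoc, e2, hf, tsum_mul_tsum_eq_tsum_sum_antidiagonal_of_summable_norm
        (summable_mul_pow hpb (habs y hy) hm.le) (summable_mul_pow hcb (habs y hy) hm.le)]
      refine tsum_congr fun n => ?_
      rw [hformal, sum_mul]
      refine Finset.sum_congr rfl fun ij hij => ?_
      rw [← mem_antidiagonal.1 hij, pow_add]
      ring
    have h := (hf' y hy).mul (hl' y hy).neg.exp
    refine h.congr_deriv ?_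
    rw [hode]
    ring
  have hcont : ContinuousOn (fun y => f y * Real.exp (-l y)) (Set.Icc 0 t) := fun y hy =>
    ((hf' y hy).continuousAt.mul (hl' y hy).continuousAt.neg.rexp).continuousWithinAt
  have hf0 : f 0 = 1 := by
    rw [hf]
    simp only
    rw [tsum_eq_single 0 fun n hn => by simp [hn]]
    simp [hc0]
  have hl0 : l 0 = 0 := by
    rw [hl]
    simp only
    rw [tsum_eq_single 0 fun n hn => by simp [hn]]
    simp
  rcases ht0.eq_or_lt with rfl | ht0
  · change f 0 = Real.exp (l 0)
    rw [hf0, hl0, Real.exp_zero]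
  · obtain ⟨y, hy, hslope⟩ := exists_hasDerivAt_eq_slope (fun y => f y * Real.exp (-l y)) (fun _ => 0)
      ht0 hcont fun y hy => hg' y (Set.Ioo_subset_Icc_self hy) hy.1
    rw [eq_comm, div_eq_zero_iff, or_iff_left (by linarith), hf0, hl0, neg_zero, Real.exp_zero,
      one_mul, sub_eq_zero, Real.exp_neg, ← div_eq_mul_inv, div_eq_iff (Real.exp_ne_zero _),
      one_mul] at hslope
    exact hslope

/-- Two real power series which have the same sum on an interval to the right of `0` have the same
coefficients. -/
theorem eq_of_hasSum_mul_pow {f g : ℕ → ℝ} {ε : ℝ} (hε : 0 < ε)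
    (h : ∀ t, 0 < t → t < ε → ∃ s, HasSum (fun n => f n * t ^ n) s ∧ HasSum (fun n => g n * t ^ n) s) :
    f = g := by
  set a := fun n => f n - g n with ha
  have hsum : ∀ t, 0 < t → t < ε → HasSum (fun n => a n * t ^ n) 0 := by
    intro t h0 h1
    obtain ⟨s, hs1, hs2⟩ := h t h0 h1
    simpa [ha, sub_mul] using hs1.sub hs2
  set P := FormalMultilinearSeries.ofScalars ℝ a with hP
  have hr : 0 < P.radius := by
    have hε' : 0 < ε / 2 := by positivity
    have := P.le_radius_of_summable_norm (r := ⟨ε / 2, hε'.le⟩) (by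
      refine (hsum (ε / 2) hε' (by linarith)).summable.norm.congr fun n => ?_
      rw [hP, FormalMultilinearSeries.ofScalars_norm, norm_mul, norm_pow,
        Real.norm_of_nonneg hε'.le]
      rfl)
    refine lt_of_lt_of_le (ENNReal.coe_pos.2 ?_) this
    exact hε'
  have hfp := (P.hasFPowerSeriesOnBall hr).hasFPowerSeriesAt
  have hz : ∃ᶠ z in 𝓝[≠] (0 : ℝ), P.sum z = 0 := by
    have : ∀ᶠ z in 𝓝[>] (0 : ℝ), P.sum z = 0 := by
      filter_upwards [Ioo_mem_nhdsGT hε] with z hz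
      have := (hsum z hz.1 hz.2).tsum_eq
      simpa [FormalMultilinearSeries.sum, hP, FormalMultilinearSeries.ofScalars_apply_eq,
        mul_comm] using this
    exact this.frequently.filter_mono (nhdsWithin_mono _ fun z (hz : 0 < z) => hz.ne')
  have hz' := (hfp.analyticAt.frequently_zero_iff_eventually_zero).1 hz
  have hP0 : P = 0 := HasFPowerSeriesAt.eq_zero (hfp.congr hz')
  rw [hP, FormalMultilinearSeries.ofScalars_series_eq_zero] at hP0
  funext n
  exact sub_eq_zero.1 (congrFun hP0 n)

end Analytic

/-! ### The integral as a hypergeometric series -/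

section CharI

theorem succ_mul_choose_succ (a : ℝ) (n : ℕ) :
    (n + 1) * Ring.choose a (n + 1) = (a - n) * Ring.choose a n := by
  have h1 := Ring.descPochhammer_eq_factorial_smul_choose a n
  have h2 := Ring.descPochhammer_eq_factorial_smul_choose a (n + 1)
  rw [descPochhammer_succ_right, Polynomial.smeval_mul, h1, Polynomial.smeval_sub,
    Polynomial.smeval_X, Polynomial.smeval_natCast, Nat.factorial_succ] at h2
  have h3 : (n.factorial : ℝ) ≠ 0 := by positivity
  simp only [pow_one, pow_zero, nsmul_eq_mul, mul_one] at h2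
  push_cast at h2
  refine mul_left_cancel₀ h3 ?_
  linear_combination -h2

/-- The coefficients of the hypergeometric function `₂F₁(x, -x; 1; t)`. -/
noncomputable def hyperCoeff (x : ℝ) (n : ℕ) : ℝ := Ring.choose (-x) n * Ring.choose x n

theorem sq_mul_hyperCoeff_succ (x : ℝ) (n : ℕ) :
    ((n + 1 : ℕ) : ℝ) ^ 2 * hyperCoeff x (n + 1) = (n ^ 2 - x ^ 2) * hyperCoeff x n := by
  have h1 := succ_mul_choose_succ (-x) n
  have h2 := succ_mul_choose_succ x n
  rw [hyperCoeff, hyperCoeff]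
  push_cast
  linear_combination ((n + 1) * Ring.choose x (n + 1)) * h1 + (-x - n) * Ring.choose (-x) n * h2

/-- The two-term recurrence telescopes; this is the coefficient form of (t d/dt)² F = -x² t/(1 - t)
· F. -/
theorem sq_mul_hyperCoeff (x : ℝ) (n : ℕ) :
    (n : ℝ) ^ 2 * hyperCoeff x n = -x ^ 2 * ∑ k ∈ range n, hyperCoeff x k := by
  induction n with
  | zero => simp
  | succ n ih =>
    rw [sq_mul_hyperCoeff_succ, sum_range_succ, mul_add, ← ih]
    ring

theorem sq_mul_hyperCoeff_eq_sum_antidiagonal (x : ℝ) (n : ℕ) :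
    (n : ℝ) ^ 2 * hyperCoeff x n = ∑ ij ∈ antidiagonal n,
      (if ij.1 = 0 then 0 else -x ^ 2) * hyperCoeff x ij.2 := by
  rw [sq_mul_hyperCoeff]
  cases n with
  | zero => simp
  | succ n =>
    rw [Finset.Nat.sum_antidiagonal_succ, Finset.Nat.sum_antidiagonal_eq_sum_range_succ_mk, mul_sum,
      ← sum_range_reflect]
    simp

theorem hasSum_choose_mul_pow (x : ℝ) {z : ℂ} (hz : ‖z‖ < 1) :
    HasSum (fun n => ((Ring.choose x n : ℝ) : ℂ) * z ^ n) ((1 + z) ^ (x : ℂ)) := by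
  have := (Complex.one_add_cpow_hasFPowerSeriesOnBall_zero (a := (x : ℂ))).hasSum (y := z)
    (by simpa [Metric.eball, ← ofReal_norm, edist_eq_enorm_sub] using hz)
  rw [zero_add] at this
  refine (congrArg (HasSum · _) (funext fun n => ?_)).mp this
  rw [binomialSeries_apply, Complex.ofReal_choose]
  simp

theorem hasSum_mul_prod {f g : ℕ → ℂ} {s t : ℂ} (hf : HasSum f s) (hg : HasSum g t) :
    HasSum (fun nm : ℕ × ℕ => f nm.1 * g nm.2) (s * t) :=
  HasSum.mul (f := f) (g := g) hf hg
    (summable_mul_of_summable_norm (f := f) (g := g) hf.summable.norm hg.summable.norm)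

/-- Positive real part keeps w off the branch cut, so log(conj w) = conj(log w) and -2i arg w =
log(conj w) - log w. -/
theorem exp_arg_eq_cpow_mul_cpow (x : ℝ) {w : ℂ} (hw : 0 < w.re) :
    Complex.exp (-(Complex.I * ((2 * x : ℝ) : ℂ) * (w.arg : ℂ))) =
      w ^ ((-x : ℝ) : ℂ) * (starRingEnd ℂ w) ^ (x : ℂ) := by
  have hw0 : w ≠ 0 := fun h => by simp [h] at hw
  have harg : w.arg ≠ Real.pi := fun h => by
    rw [Complex.arg_eq_pi_iff] at h
    linarith
  rw [Complex.cpow_def_of_ne_zero hw0, Complex.cpow_def_of_ne_zero (by simpa using hw0),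
    Complex.log_conj _ harg, ← Complex.exp_add]
  congr 1
  rw [Complex.log]
  simp only [map_add, map_mul, Complex.conj_ofReal, Complex.conj_I]
  push_cast
  ring

theorem integral_exp_int_mul (k : ℤ) :
    ∫ θ in (0 : ℝ)..(2 * Real.pi), Complex.exp (Complex.I * k * θ) =
      if k = 0 then 2 * (Real.pi : ℂ) else 0 := by
  split_ifs with hk
  · simp [hk]
  · rw [integral_exp_mul_complex (by simpa using hk)]
    have : Complex.exp (Complex.I * k * ((2 * Real.pi : ℝ) : ℂ)) = 1 := by
      rw [← Complex.exp_int_mul_two_pi_mul_I k]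
      congr 1
      push_cast
      ring
    rw [this]
    simp

theorem hasSum_charI {b : ℝ} (hb : 1 < b) (x : ℝ) :
    HasSum (fun n => ((hyperCoeff x n * ((b ^ 2)⁻¹) ^ n : ℝ) : ℂ)) (charI b (2 * x)) := by
  have hb0 : 0 < b := by linarith
  set r : ℂ := -(b : ℂ)⁻¹ with hr
  have hrn : ‖r‖ < 1 := by
    rw [hr, norm_neg, norm_inv, Complex.norm_of_nonneg hb0.le]
    exact inv_lt_one_of_one_lt₀ hb
  set α : ℕ → ℂ := fun n => ((Ring.choose (-x) n : ℝ) : ℂ) * r ^ n with hα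
  set β : ℕ → ℂ := fun n => ((Ring.choose x n : ℝ) : ℂ) * r ^ n with hβ
  have hαs : Summable fun n => ‖α n‖ := by
    exact (hasSum_choose_mul_pow (-x) hrn).summable.norm
  have hβs : Summable fun n => ‖β n‖ := (hasSum_choose_mul_pow x hrn).summable.norm
  set F : ℕ × ℕ → ℝ → ℂ := fun nm θ =>
    α nm.1 * β nm.2 * Complex.exp (Complex.I * ((nm.1 - nm.2 : ℤ) : ℂ) * θ) with hF
  have hint : HasSum (fun nm => ∫ θ in (0 : ℝ)..(2 * Real.pi), F nm θ)
      (∫ θ in (0 : ℝ)..(2 * Real.pi), Complex.exp (-(Complex.I * ((2 * x : ℝ) : ℂ) *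
      (Complex.arg (1 - (b : ℂ)⁻¹ * Complex.exp (Complex.I * (θ : ℂ))) : ℂ)))) := by
    refine intervalIntegral.hasSum_integral_of_dominated_convergence
      (fun nm _ => ‖α nm.1‖ * ‖β nm.2‖) (fun nm => ?_) (fun nm => ?_) ?_ ?_ ?_
    · exact (Continuous.aestronglyMeasurable (by fun_prop))
    · refine Eventually.of_forall fun θ _ => ?_
      have : ‖Complex.exp (Complex.I * ((nm.1 - nm.2 : ℤ) : ℂ) * θ)‖ = 1 := by
        rw [Complex.norm_exp]
        simp
      rw [hF]
      simp only [norm_mul, this, mul_one, le_refl]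
    · exact Eventually.of_forall fun θ _ => hαs.mul_of_nonneg hβs (fun _ => norm_nonneg _)
        fun _ => norm_nonneg _
    · exact intervalIntegrable_const
    · refine Eventually.of_forall fun θ _ => ?_
      set z := Complex.exp (Complex.I * θ) with hz
      have hz1 : ‖z‖ = 1 := by rw [hz, mul_comm, Complex.norm_exp_ofReal_mul_I]
      have hrz : ‖r * z‖ < 1 := by rw [norm_mul, hz1, mul_one]; exact hrn
      have hrz' : ‖r * starRingEnd ℂ z‖ < 1 := by
        rw [norm_mul, RCLike.norm_conj, hz1, mul_one]; exact hrn
      have hw : 1 - (b : ℂ)⁻¹ * z = 1 + r * z := by rw [hr]; ring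
      have hwc : starRingEnd ℂ (1 + r * z) = 1 + r * starRingEnd ℂ z := by
        simp [hr]
      have hre : 0 < (1 + r * z).re := by
        have := (abs_le.1 (Complex.abs_re_le_norm (r * z))).1
        rw [Complex.add_re, Complex.one_re]
        linarith
      rw [hw, exp_arg_eq_cpow_mul_cpow x hre, hwc]
      have h1 := hasSum_choose_mul_pow (-x) hrz
      have h2 := hasSum_choose_mul_pow x hrz'
      have h := hasSum_mul_prod h1 h2
      refine (congrArg (HasSum · _) (funext fun nm => ?_)).mp h
      have hzc : starRingEnd ℂ z = Complex.exp (-(Complex.I * θ)) := by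
        rw [hz, ← Complex.exp_conj]
        simp
      have hexp : Complex.exp (Complex.I * ((nm.1 - nm.2 : ℤ) : ℂ) * θ) =
          z ^ nm.1 * (starRingEnd ℂ z) ^ nm.2 := by
        rw [hzc, hz, ← Complex.exp_nat_mul, ← Complex.exp_nat_mul, ← Complex.exp_add]
        congr 1
        push_cast
        ring
      rw [hF, hα, hβ]
      simp only
      rw [hexp, mul_pow, mul_pow]
      ring
  -- Terms with n ≠ m integrate to 0, so the double sum lives on the image of n ↦ (n, n).
  have hdiag := ((Function.Injective.hasSum_iff (f := fun nm : ℕ × ℕ =>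
    ∫ θ in (0 : ℝ)..(2 * Real.pi), F nm θ) (g := fun n : ℕ => (n, n))
    (fun m n h => (Prod.ext_iff.1 h).1) ?_).2 hint).mul_left (1 / (2 * (Real.pi : ℂ)))
  · rw [charI]
    refine (congrArg (HasSum · _) (funext fun n => ?_)).mp hdiag
    have hpi : (Real.pi : ℂ) ≠ 0 := by exact_mod_cast Real.pi_ne_zero
    have hr2 : r ^ n * r ^ n = ((b : ℂ) ^ 2)⁻¹ ^ n := by
      rw [← mul_pow, hr, neg_mul_neg, ← mul_inv, ← pow_two]
    simp only [Function.comp, hF]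
    rw [intervalIntegral.integral_const_mul, integral_exp_int_mul, if_pos (sub_self _), hyperCoeff,
      hα, hβ]
    push_cast
    rw [← hr2]
    field_simp
  · rintro ⟨n, m⟩ hnm
    have hne : (n : ℤ) - m ≠ 0 := fun h => hnm ⟨n, by
      have : n = m := by omega
      rw [this]⟩
    simp only [hF]
    rw [intervalIntegral.integral_const_mul, integral_exp_int_mul, if_neg hne, mul_zero]

end CharI

/-! ### Laguerre polynomials have real positive zeros -/

section Laguerre

/-- For real r, the imaginary part of 1/(z - r) has the sign opposite to that of z, so the terms
cannot cancel. -/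
theorem Multiset.mul_im_sum_one_div_sub_neg {z : ℂ} (hz : z.im ≠ 0) (s : Multiset ℂ)
    (hs : ∀ r ∈ s, r.im = 0) :
    s = 0 ∨ z.im * ((s.map fun r => 1 / (z - r)).sum).im < 0 := by
  induction s using Multiset.induction with
  | empty => exact Or.inl rfl
  | cons r s ih =>
    right
    have hr : r.im = 0 := hs r (Multiset.mem_cons_self _ _)
    have hzr : 0 < Complex.normSq (z - r) := by
      rw [Complex.normSq_pos]
      intro h
      apply hz
      rw [sub_eq_zero.1 h, hr]
    have h1 : z.im * (1 / (z - r)).im < 0 := by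
      rw [one_div, Complex.inv_im, Complex.sub_im, hr, sub_zero, mul_div_assoc']
      have : 0 < z.im ^ 2 := by positivity
      exact div_neg_of_neg_of_pos (by nlinarith) hzr
    rw [Multiset.map_cons, Multiset.sum_cons, Complex.add_im, mul_add]
    rcases ih fun r' hr' => hs r' (Multiset.mem_cons_of_mem hr') with rfl | h2
    · simpa using h1
    · linarith

namespace Polynomial

theorem sub_derivative_ne_zero {P : ℂ[X]} (hP : P ≠ 0) : P - derivative P ≠ 0 := by
  intro h
  have h1 := degree_derivative_lt hP
  rw [← sub_eq_zero.1 h] at h1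
  exact lt_irrefl _ h1

/-- At a non-real root, 1 = P'/P = ∑ 1/(z - r) over the real roots r of P, yet that sum is either
empty or non-real. -/
theorem im_eq_zero_of_isRoot_sub_derivative {P : ℂ[X]} (hP : P ≠ 0)
    (hroots : ∀ z, P.IsRoot z → z.im = 0) {z : ℂ} (hz : (P - derivative P).IsRoot z) :
    z.im = 0 := by
  by_contra him
  have hPz : P.eval z ≠ 0 := fun h => him (hroots z h)
  have h1 := (IsAlgClosed.splits P).eval_derivative_div_eval_of_ne_zero hPz
  have h2 : P.derivative.eval z = P.eval z := by
    rw [IsRoot.def, eval_sub, sub_eq_zero] at hz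
    exact hz.symm
  rw [h2, div_self hPz] at h1
  rcases Multiset.mul_im_sum_one_div_sub_neg him P.roots
    fun r hr => hroots r ((mem_roots hP).1 hr) with h | h
  · simp [h] at h1
  · rw [← h1, Complex.one_im, mul_zero] at h
    exact lt_irrefl _ h

/-- The operator `1 - d/dX` on complex polynomials. -/
noncomputable def oneSubDerivative : Module.End ℂ ℂ[X] := 1 + -derivative

/-- Up to the factor `(-1)ⁿ n!`, the Laguerre polynomial of degree `n`. -/
noncomputable def laguerre (n : ℕ) : ℂ[X] :=
  (oneSubDerivative ^ n) (X ^ n)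

theorem laguerre_roots_real (n : ℕ) :
    laguerre n ≠ 0 ∧ ∀ z, (laguerre n).IsRoot z → z.im = 0 := by
  suffices h : ∀ k : ℕ, (oneSubDerivative ^ k) (X ^ n) ≠ 0 ∧
      ∀ z, ((oneSubDerivative ^ k) (X ^ n)).IsRoot z → z.im = 0 from h n
  intro k
  induction k with
  | zero =>
    refine ⟨by simp, fun z hz => ?_⟩
    have : z = 0 := by
      have hz' : z ^ n = 0 := by simpa using hz
      exact eq_zero_of_pow_eq_zero hz'
    simp [this]
  | succ k ih =>
    rw [pow_succ', Module.End.mul_apply, oneSubDerivative, LinearMap.add_apply, Module.End.one_apply,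
      LinearMap.neg_apply, ← sub_eq_add_neg]
    exact ⟨sub_derivative_ne_zero ih.1, fun z hz =>
      im_eq_zero_of_isRoot_sub_derivative ih.1 ih.2 hz⟩

theorem eval_laguerre (n : ℕ) (x : ℂ) :
    (laguerre n).eval x = (-1) ^ n * n.factorial *
      ∑ k ∈ range (n + 1), (n.choose k : ℂ) * (-x) ^ k / k.factorial := by
  rw [laguerre, oneSubDerivative, (Commute.one_left _).add_pow, LinearMap.sum_apply, eval_finsetSum, mul_sum]
  refine Finset.sum_congr rfl fun k hk => ?_
  have hk : k ≤ n := Nat.lt_succ_iff.1 (mem_range.1 hk)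
  have h1 : (1 ^ k * (-derivative : Module.End ℂ ℂ[X]) ^ (n - k) * ((n.choose k : ℕ) : Module.End ℂ ℂ[X])) (X ^ n) =
      C ((n.choose k : ℂ) * (-1) ^ (n - k)) * (derivative^[n - k] (X ^ n)) := by
    have hD : ∀ (j : ℕ) (p : ℂ[X]),
        ((-derivative : Module.End ℂ ℂ[X]) ^ j) p = C ((-1) ^ j) * derivative^[j] p := by
      intro j p
      induction j with
      | zero => simp
      | succ j ih =>
        rw [pow_succ', Module.End.mul_apply, ih, LinearMap.neg_apply, derivative_C_mul,
          Function.iterate_succ_apply', pow_succ]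
        simp
    rw [one_pow, one_mul, Module.End.mul_apply, hD, Module.End.natCast_apply, nsmul_eq_mul,
      iterate_derivative_natCast_mul]
    simp only [map_mul, map_natCast]
    ring
  rw [h1, iterate_derivative_X_pow_eq_C_mul, Nat.sub_sub_self hk]
  have h2 : (n.factorial : ℂ) = k.factorial * n.descFactorial (n - k) := by
    have := Nat.factorial_mul_descFactorial (Nat.sub_le n k)
    rw [Nat.sub_sub_self hk] at this
    exact_mod_cast this.symm
  have h3 : (-1 : ℂ) ^ n = (-1) ^ (n - k) * (-1) ^ k := by
    rw [← pow_add, Nat.sub_add_cancel hk]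
  have h4 : ((-1 : ℂ) ^ k) * (-1) ^ k = 1 := by rw [← mul_pow]; simp
  have h5 : (k.factorial : ℂ) ≠ 0 := by exact_mod_cast k.factorial_ne_zero
  rw [h2, h3, neg_pow x]
  simp only [eval_mul, eval_C, eval_pow, eval_X]
  field_simp
  linear_combination (-(n.choose k : ℂ) * x ^ k) * h4

end Polynomial

theorem List.antitone_getD_of_sorted {l : List ℝ} (h0 : ∀ x ∈ l, 0 ≤ x)
    (hl : l.Pairwise (· ≥ ·)) : Antitone fun k => l.getD k 0 := by
  refine antitone_nat_of_succ_le fun k => ?_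
  induction l generalizing k with
  | nil => simp
  | cons x l ih =>
    cases k with
    | zero =>
      cases l with
      | nil => simpa using h0
      | cons y l => simpa using (List.pairwise_cons.1 hl).1 y (by simp)
    | succ k =>
      simpa using ih (fun y hy => h0 y (List.mem_cons_of_mem _ hy)) (List.pairwise_cons.1 hl).2 k

theorem List.prod_range_getD (l : List ℝ) (f : ℝ → ℝ) :
    ∏ k ∈ Finset.range l.length, f (l.getD k 0) = (l.map f).prod := by
  induction l with
  | nil => simp
  | cons x l ih =>
    rw [List.length_cons, Finset.prod_range_succ', List.map_cons, List.prod_cons, mul_comm]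
    simp only [List.getD_cons_succ, List.getD_cons_zero, ih]

/-- Padding by zeros puts root sets of all sizes into one sequence space, ready for a compactness
argument. -/
theorem Multiset.exists_antitone_enumeration (s : Multiset ℝ) (h0 : ∀ x ∈ s, 0 ≤ x) :
    ∃ (K : ℕ) (a : ℕ → ℝ), Antitone a ∧ (∀ k, 0 ≤ a k) ∧ (∀ k, K ≤ k → a k = 0) ∧
      ∀ f : ℝ → ℝ, ∏ k ∈ Finset.range K, f (a k) = (s.map f).prod := by
  set l := s.sort (· ≥ ·) with hl
  have hls : (l : Multiset ℝ) = s := Multiset.sort_eq _ _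
  have hl0 : ∀ x ∈ l, 0 ≤ x := fun x hx => h0 x (by rwa [← hls])
  refine ⟨l.length, fun k => l.getD k 0,
    List.antitone_getD_of_sorted hl0 (s.pairwise_sort _), fun k => ?_, fun k hk => ?_,
    fun f => ?_⟩
  · rcases lt_or_ge k l.length with h | h
    · simp only [List.getD_eq_getElem l 0 h]
      exact hl0 _ (List.getElem_mem h)
    · simp only [List.getD_eq_default l 0 h, le_refl]
  · exact List.getD_eq_default l 0 hk
  · rw [List.prod_range_getD, ← hls, Multiset.map_coe, Multiset.prod_coe]

/-- The values `L_n(s / n)` of the Laguerre polynomials. -/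
noncomputable def scaledLaguerre (n : ℕ) (s : ℝ) : ℝ :=
  ∑ k ∈ range (n + 1), (n.choose k : ℝ) * (-(s / n)) ^ k / k.factorial

theorem exists_scaledLaguerre_eq_prod (n : ℕ) :
    ∃ (K : ℕ) (a : ℕ → ℝ), Antitone a ∧ (∀ k, 0 ≤ a k) ∧ (∀ k, K ≤ k → a k = 0) ∧
      ∀ s, ∏ k ∈ Finset.range K, (1 - s * a k) = scaledLaguerre n s := by
  obtain ⟨hne, hreal⟩ := Polynomial.laguerre_roots_real n
  set M := (Polynomial.laguerre n).roots with hM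
  have hMreal : ∀ z ∈ M, (z.re : ℂ) = z := fun z hz =>
    Complex.ext rfl (by simpa using (hreal z ((Polynomial.mem_roots hne).1 hz)).symm)
  have heval : ∀ x : ℝ, (Polynomial.laguerre n).eval (x : ℂ) =
      (((-1) ^ n * n.factorial *
        ∑ k ∈ range (n + 1), (n.choose k : ℝ) * (-x) ^ k / k.factorial : ℝ) : ℂ) := fun x => by
    rw [Polynomial.eval_laguerre]
    push_cast
    rfl
  -- At x ≤ 0 all terms of the sum are nonnegative and the k = 0 term is 1.
  have hpos : ∀ z ∈ M, 0 < z.re := by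
    intro z hz
    by_contra hz0
    have h1 := (Polynomial.mem_roots hne).1 hz
    rw [Polynomial.IsRoot.def, ← hMreal z hz, heval, Complex.ofReal_eq_zero] at h1
    have h2 : 0 < ∑ k ∈ range (n + 1), (n.choose k : ℝ) * (-z.re) ^ k / k.factorial := by
      have h3 : 0 ≤ -z.re := by linarith
      rw [sum_range_succ']
      have : 0 ≤ ∑ k ∈ range n, (n.choose (k + 1) : ℝ) * (-z.re) ^ (k + 1) / (k + 1).factorial :=
        Finset.sum_nonneg fun k _ => by positivity
      simp only [Nat.choose_zero_right, pow_zero, Nat.factorial_zero]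
      norm_num
      linarith
    have h4 : ((-1 : ℝ) ^ n * n.factorial) ≠ 0 :=
      mul_ne_zero (by simp) (by exact_mod_cast n.factorial_ne_zero)
    exact h2.ne' ((mul_eq_zero.1 h1).resolve_left h4)
  obtain ⟨K, a, ha, ha0, haK, hprod⟩ := Multiset.exists_antitone_enumeration
    (M.map fun z => 1 / (n * z.re)) (by
      intro x hx
      obtain ⟨z, hz, rfl⟩ := Multiset.mem_map.1 hx
      have := hpos z hz
      positivity)
  refine ⟨K, a, ha, ha0, haK, fun s => ?_⟩
  rw [hprod (fun y => 1 - s * y), Multiset.map_map]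
  have h1 := (IsAlgClosed.splits (Polynomial.laguerre n)).eval_eq_prod_roots
  have h4 : (((-1 : ℝ) ^ n * n.factorial : ℝ) : ℂ) ≠ 0 := by
    rw [Complex.ofReal_ne_zero]
    exact mul_ne_zero (by simp) (by exact_mod_cast n.factorial_ne_zero)
  have h0 : (Polynomial.laguerre n).eval 0 = (((-1 : ℝ) ^ n * n.factorial : ℝ) : ℂ) := by
    have := heval 0
    rw [sum_range_succ', Finset.sum_eq_zero fun k _ => by simp] at this
    simpa using this
  have h2 : (Polynomial.laguerre n).eval ((s / n : ℝ) : ℂ) = (Polynomial.laguerre n).eval 0 *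
      (((M.map ((fun y => 1 - s * y) ∘ fun z => 1 / (n * z.re))).prod : ℝ) : ℂ) := by
    have h3 := map_multiset_prod Complex.ofRealHom
      (M.map ((fun y => 1 - s * y) ∘ fun z => 1 / (n * z.re)))
    rw [Complex.ofRealHom_eq_coe] at h3
    rw [h1, h1, mul_assoc, h3, Multiset.map_map,
      ← Multiset.prod_map_mul]
    congr 2
    refine Multiset.map_congr rfl fun z hz => ?_
    have hz0 : (z.re : ℂ) ≠ 0 := by exact_mod_cast (hpos z hz).ne'
    conv_lhs => rw [← hMreal z hz]
    simp only [Function.comp, Complex.ofRealHom_eq_coe]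
    conv_rhs => enter [1]; rw [← hMreal z hz]
    push_cast
    rcases eq_or_ne (n : ℂ) 0 with hn | hn
    · simp [hn]
    · field_simp
      ring
  rw [heval, h0, Complex.ofReal_mul] at h2
  exact_mod_cast (mul_left_cancel₀ h4 h2).symm

end Laguerre

/-! ### The product formula as a limit of Laguerre polynomials -/

section BesselProduct

/-- The entire function `∑ (-s)ᵏ / k!²`, so that `J₀(z) = besselSeries (z² / 4)`. -/
noncomputable def besselSeries (s : ℝ) : ℝ := ∑' k : ℕ, (-s) ^ k / (k.factorial : ℝ) ^ 2

theorem summable_besselSeries (s : ℝ) :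
    Summable fun k : ℕ => (-s) ^ k / (k.factorial : ℝ) ^ 2 := by
  refine Summable.of_norm_bounded (Real.summable_pow_div_factorial |s|) fun k => ?_
  have h : (1 : ℝ) ≤ k.factorial := by exact_mod_cast Nat.one_le_iff_ne_zero.2 k.factorial_ne_zero
  rw [norm_div, norm_pow, norm_neg, Real.norm_eq_abs, norm_pow, Real.norm_natCast]
  gcongr
  exact le_self_pow₀ h two_ne_zero

theorem scaledLaguerre_eq_tsum (n : ℕ) (s : ℝ) :
    scaledLaguerre n s = ∑' k : ℕ, (n.choose k : ℝ) * (-(s / n)) ^ k / k.factorial := by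
  rw [scaledLaguerre, tsum_eq_sum]
  intro k hk
  rw [Nat.choose_eq_zero_of_lt (by simpa using hk)]
  simp

theorem choose_mul_div_pow_le (n k : ℕ) {y : ℝ} (hy : 0 ≤ y) :
    (n.choose k : ℝ) * (y / n) ^ k ≤ y ^ k / k.factorial := by
  calc (n.choose k : ℝ) * (y / n) ^ k ≤ (n ^ k / k.factorial) * (y / n) ^ k := by
        gcongr
        exact Nat.choose_le_pow_div k n
    _ = (y ^ k / k.factorial) * ((n : ℝ) ^ k / n ^ k) := by rw [div_pow]; ring
    _ ≤ y ^ k / k.factorial := mul_le_of_le_one_right (by positivity) (div_self_le_one _)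

theorem tendsto_scaledLaguerre (s : ℝ) :
    Tendsto (fun n => scaledLaguerre n s) atTop (𝓝 (besselSeries s)) := by
  simp_rw [scaledLaguerre_eq_tsum]
  refine tendsto_tsum_of_dominated_convergence (Real.summable_pow_div_factorial |s|) (fun k => ?_)
    (Eventually.of_forall fun n k => ?_)
  · have h := ProbabilityTheory.tendsto_choose_mul_pow_atTop (p := fun n : ℕ => -(s / n)) (r := -s) (k := k) (by
      refine tendsto_const_nhds.congr' ?_
      filter_upwards [eventually_ne_atTop 0] with n hn
      have : (n : ℝ) ≠ 0 := by exact_mod_cast hn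
      field_simp)
    have h' := h.div_const (k.factorial : ℝ)
    rwa [div_div, ← pow_two] at h'
  · have h : (1 : ℝ) ≤ k.factorial := by
      exact_mod_cast Nat.one_le_iff_ne_zero.2 k.factorial_ne_zero
    rw [norm_div, norm_mul, norm_pow, norm_neg, norm_div, Real.norm_natCast, Real.norm_natCast,
      Real.norm_natCast, Real.norm_eq_abs]
    exact (div_le_self (by positivity) h).trans (choose_mul_div_pow_le n k (abs_nonneg s))

/-- Writing yᵏ/k!² = (√yᵏ/k!)² gives growth of order 1/2 uniformly in n, the source of the quadratic
decay of the reciprocal zeros. -/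
theorem scaledLaguerre_neg_le (n : ℕ) {y : ℝ} (hy : 0 ≤ y) :
    scaledLaguerre n (-y) ≤ Real.exp (2 * √y) := by
  calc scaledLaguerre n (-y) ≤ ∑ k ∈ range (n + 1), (√y ^ k / k.factorial) ^ 2 := by
        refine Finset.sum_le_sum fun k _ => ?_
        have h : (√y ^ k / k.factorial) ^ 2 = y ^ k / k.factorial / k.factorial := by
          rw [div_pow, ← pow_mul, mul_comm k, pow_mul, Real.sq_sqrt hy, div_div, ← pow_two]
        rw [h, neg_div, neg_neg]
        gcongr
        exact choose_mul_div_pow_le n k hy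
    _ ≤ (∑ k ∈ range (n + 1), √y ^ k / k.factorial) ^ 2 :=
        Finset.sum_sq_le_sq_sum_of_nonneg fun k _ => by positivity
    _ ≤ Real.exp √y ^ 2 := by
        gcongr
        exact Real.sum_le_exp_of_nonneg (Real.sqrt_nonneg y) _
    _ = Real.exp (2 * √y) := by rw [two_mul, Real.exp_add, pow_two]

theorem le_exp_two_div_sq_of_prod_eq {n K : ℕ} {a : ℕ → ℝ} (ha : Antitone a) (ha0 : ∀ k, 0 ≤ a k)
    (haK : ∀ k, K ≤ k → a k = 0) (hprod : ∀ s, ∏ k ∈ range K, (1 - s * a k) = scaledLaguerre n s)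
    (k : ℕ) : a k ≤ Real.exp 2 / (k + 1) ^ 2 := by
  rcases le_or_gt K k with hk | hk
  · rw [haK k hk]
    positivity
  -- This y makes √y the number of factors in (1 + y aₖ)^(k+1), so (k + 1)-th roots leave the
  -- constant e².
  · set y : ℝ := (k + 1) ^ 2 with hy
    have hy0 : 0 < y := by positivity
    have h1 : (1 + y * a k) ^ (k + 1) ≤ Real.exp 2 ^ (k + 1) := by
      calc (1 + y * a k) ^ (k + 1) = ∏ i ∈ range (k + 1), (1 + y * a k) := by simp
        _ ≤ ∏ i ∈ range (k + 1), (1 + y * a i) := by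
          refine Finset.prod_le_prod (fun i _ => ?_) fun i hi => ?_
          · have := ha0 k
            positivity
          · gcongr
            exact ha (Nat.lt_succ_iff.1 (mem_range.1 hi))
        _ ≤ ∏ i ∈ range K, (1 + y * a i) := by
          refine Finset.prod_le_prod_of_subset_of_one_le (range_subset_range.2 hk) (fun i _ => ?_)
            fun i _ _ => ?_
          · have := ha0 i
            positivity
          · have := mul_nonneg hy0.le (ha0 i)
            linarith
        _ = scaledLaguerre n (-y) := by simpa using hprod (-y)
        _ ≤ Real.exp (2 * √y) := scaledLaguerre_neg_le n hy0.le
        _ = Real.exp 2 ^ (k + 1) := by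
          rw [hy, Real.sqrt_sq (by positivity), ← Real.exp_nat_mul]
          push_cast
          ring_nf
    have h2 := le_of_pow_le_pow_left₀ (Nat.succ_ne_zero k) (Real.exp_pos 2).le h1
    rw [le_div_iff₀ hy0]
    linarith

/-- The product formula `∑ (-s)ᵏ / k!² = ∏ (1 - s aₖ)`. -/
theorem exists_besselSeries_eq_tprod :
    ∃ a : ℕ → ℝ, Antitone a ∧ (∀ k, 0 ≤ a k) ∧ Summable a ∧
      ∀ s, besselSeries s = ∏' k, (1 + -(s * a k)) := by
  choose K A hA hA0 hAK hprod using exists_scaledLaguerre_eq_prod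
  have hbound := fun n => le_exp_two_div_sq_of_prod_eq (hA n) (hA0 n) (hAK n) (hprod n)
  -- By Tychonoff a subsequence of the root sequences converges termwise; the summable bound then
  -- lets the products converge.
  have hcompact : IsCompact (Set.univ.pi fun k : ℕ => Set.Icc 0 (Real.exp 2 / ((k : ℝ) + 1) ^ 2)) :=
    isCompact_univ_pi fun k => isCompact_Icc
  obtain ⟨a, ha, φ, hφ, hlim⟩ := hcompact.tendsto_subseq fun n => by
    exact fun k _ => ⟨hA0 n k, hbound n k⟩
  have hlim' : ∀ k, Tendsto (fun n => A (φ n) k) atTop (𝓝 (a k)) := fun k =>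
    (tendsto_pi_nhds.1 hlim) k
  have hsum : Summable fun k : ℕ => Real.exp 2 / ((k : ℝ) + 1) ^ 2 := by
    have := ((summable_nat_add_iff 1).2 (Real.summable_one_div_nat_pow.2 one_lt_two)).mul_left (Real.exp 2)
    refine this.congr fun k => ?_
    push_cast
    ring
  refine ⟨a, fun i j hij => le_of_tendsto_of_tendsto' (hlim' j) (hlim' i) fun n => hA _ hij,
    fun k => (ha k trivial).1,
    Summable.of_nonneg_of_le (fun k => (ha k trivial).1) (fun k => (ha k trivial).2) hsum,
    fun s => ?_⟩
  refine tendsto_nhds_unique ((tendsto_scaledLaguerre s).comp hφ.tendsto_atTop) ?_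
  have h := tendsto_tprod_one_add_of_dominated_convergence (𝓕 := atTop)
    (f := fun n k => -(s * A (φ n) k)) (g := fun k => -(s * a k)) (hsum.mul_left |s|)
    (fun k => ((hlim' k).const_mul s).neg) (Eventually.of_forall fun n k => by
      rw [norm_neg, norm_mul, Real.norm_eq_abs, Real.norm_of_nonneg (hA0 _ _)]
      exact mul_le_mul_of_nonneg_left (hbound _ _) (abs_nonneg s))
  refine h.congr fun n => ?_
  simp only [Function.comp]
  rw [← hprod, tprod_eq_prod (s := range (K (φ n)))]
  · simp only [sub_eq_add_neg]
  · intro k hk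
    rw [hAK _ _ (by simpa using hk)]
    simp

end BesselProduct

/-! ### Simplicity of the Bessel zeros -/

section BesselZeros

theorem besselSeries_zero : besselSeries 0 = 1 := by
  rw [besselSeries, tsum_eq_single 0 fun k hk => by simp [hk]]
  simp

theorem besselJZero_ofReal (x : ℝ) : besselJZero x = besselSeries (x ^ 2 / 4) := by
  rw [besselJZero, besselSeries, Complex.ofReal_tsum]
  refine tsum_congr fun m => ?_
  have h : ((x : ℂ) / 2) ^ 2 = (x : ℂ) ^ 2 / 4 := by ring
  push_cast
  rw [pow_mul, neg_pow ((x : ℂ) ^ 2 / 4), h, div_mul_eq_mul_div]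

theorem besselJZero_eq_zero_iff (x : ℝ) : besselJZero x = 0 ↔ besselSeries (x ^ 2 / 4) = 0 := by
  rw [besselJZero_ofReal, Complex.ofReal_eq_zero]

/-- The coefficients of `besselSeries`. -/
noncomputable def besselCoeff (k : ℕ) : ℝ := (-1) ^ k / (k.factorial : ℝ) ^ 2

theorem besselSeries_eq_tsum (s : ℝ) : besselSeries s = ∑' k, besselCoeff k * s ^ k :=
  tsum_congr fun k => by rw [besselCoeff, neg_pow]; ring

theorem succ_sq_mul_besselCoeff_succ (k : ℕ) :
    ((k + 1 : ℕ) : ℝ) ^ 2 * besselCoeff (k + 1) = -besselCoeff k := by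
  have : (k.factorial : ℝ) ≠ 0 := by exact_mod_cast k.factorial_ne_zero
  rw [besselCoeff, besselCoeff, Nat.factorial_succ, pow_succ]
  push_cast
  field_simp
  ring

theorem natCast_mul_abs_besselCoeff_le (k : ℕ) : k * |besselCoeff k| ≤ 1 / k.factorial := by
  have h : (k : ℝ) ≤ k.factorial := by exact_mod_cast k.self_le_factorial
  have h0 : (0 : ℝ) < k.factorial := by exact_mod_cast k.factorial_pos
  rw [besselCoeff, abs_div, abs_pow, abs_neg, abs_one, one_pow, abs_of_pos (by positivity),
    mul_one_div, div_le_div_iff₀ (by positivity) h0]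
  nlinarith

theorem abs_besselCoeff_le (k : ℕ) : |besselCoeff k| ≤ 1 / k.factorial := by
  rcases Nat.eq_zero_or_pos k with rfl | hk
  · simp [besselCoeff]
  · have h : (1 : ℝ) ≤ k := by exact_mod_cast hk
    exact (le_mul_of_one_le_left (abs_nonneg _) h).trans (natCast_mul_abs_besselCoeff_le k)

theorem hasDerivAt_tsum_mul_pow_of_le_one_div_factorial {a : ℕ → ℝ}
    (ha : ∀ n : ℕ, |a n| ≤ 1 / n.factorial) (t : ℝ) :
    HasDerivAt (fun y => ∑' n, a n * y ^ n) (∑' n : ℕ, a n * (n * t ^ (n - 1))) t := by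
  -- Since Mⁿ/n! ≤ e^M, dividing by C = e^M reduces to a geometric bound with ratio 1/M, valid at t
  -- because |t| < M.
  set M : ℝ := |t| + 1 with hM
  have hM0 : 0 < M := by positivity
  set C := Real.exp M with hC
  have hC0 : 0 < C := Real.exp_pos _
  have hb : ∀ n, |a n / C| ≤ M⁻¹ ^ n := by
    intro n
    have h1 := Real.pow_div_factorial_le_exp M hM0.le n
    rw [abs_div, abs_of_pos hC0, inv_pow, div_le_iff₀ hC0, ← div_eq_inv_mul]
    refine (ha n).trans ?_
    rw [le_div_iff₀ (by positivity)]
    exact (by rw [one_div_mul_eq_div] : (1 : ℝ) / n.factorial * M ^ n = _).trans_le h1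
  have h := (hasDerivAt_tsum_mul_pow (t := t) hb (inv_pos.2 hM0) (by
    rw [inv_mul_lt_iff₀ hM0]; linarith)).const_mul C
  have e : ∀ n x, C * (a n / C * x) = a n * x := fun n x => by field_simp
  simpa only [← tsum_mul_left, e] using h

/-- The function `s G'(s)` for `G = besselSeries`. -/
noncomputable def besselTheta (s : ℝ) : ℝ := ∑' k : ℕ, (k * besselCoeff k) * s ^ k

theorem exists_hasDerivAt_besselSeries (s : ℝ) :
    ∃ g, HasDerivAt besselSeries g s ∧ s * g = besselTheta s := by
  have h := hasDerivAt_tsum_mul_pow_of_le_one_div_factorial abs_besselCoeff_le s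
  refine ⟨_, (funext besselSeries_eq_tsum : besselSeries = _) ▸ h, ?_⟩
  rw [besselTheta, ← tsum_mul_left]
  refine tsum_congr fun n => ?_
  cases n with
  | zero => simp
  | succ n => simp only [Nat.add_sub_cancel]; ring

theorem hasDerivAt_besselTheta (s : ℝ) : HasDerivAt besselTheta (-besselSeries s) s := by
  have h := hasDerivAt_tsum_mul_pow_of_le_one_div_factorial (a := fun k => k * besselCoeff k)
    (fun k => by
      rw [abs_mul, Nat.abs_cast]
      exact natCast_mul_abs_besselCoeff_le k) s
  refine h.congr_deriv ?_
  rw [besselSeries_eq_tsum, ← tsum_neg]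
  have hs : Summable fun n : ℕ => (n + 1 : ℕ) * besselCoeff (n + 1) * ((n + 1 : ℕ) * s ^ n) := by
    refine ((summable_besselSeries s).neg).congr fun n => ?_
    have := succ_sq_mul_besselCoeff_succ n
    have h2 : (-s) ^ n / (n.factorial : ℝ) ^ 2 = besselCoeff n * s ^ n := by
      rw [besselCoeff, neg_pow]; ring
    rw [h2]
    linear_combination (-s ^ n) * this
  rw [Summable.tsum_eq_zero_add ((summable_nat_add_iff 1).1 (by simpa using hs))]
  simp only [CharP.cast_eq_zero, zero_mul, zero_add, Nat.add_sub_cancel]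
  refine tsum_congr fun n => ?_
  linear_combination s ^ n * succ_sq_mul_besselCoeff_succ n

/-- The energy H = y G² + (y G')² has H' = G² ≥ 0 and H(0) ≥ 0. At a multiple zero s > 0 it
vanishes, forcing G = 0 on (0, s), against G(0) = 1. -/
theorem besselTheta_ne_zero {s : ℝ} (hs : 0 < s) (h0 : besselSeries s = 0) : besselTheta s ≠ 0 := by
  intro h1
  choose g hg hgθ using exists_hasDerivAt_besselSeries
  set H : ℝ → ℝ := fun y => y * besselSeries y ^ 2 + besselTheta y ^ 2 with hH
  have hH' : ∀ y, HasDerivAt H (besselSeries y ^ 2) y := fun y => by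
    refine (((hasDerivAt_id y).mul ((hg y).pow 2)).add
      ((hasDerivAt_besselTheta y).pow 2)).congr_deriv ?_
    simp only [id, one_mul, Nat.cast_ofNat, pow_one, Nat.add_one_sub_one, Pi.pow_apply]
    linear_combination (2 * besselSeries y) * hgθ y
  have hmono : Monotone H := monotone_of_deriv_nonneg (fun y => (hH' y).differentiableAt)
    fun y => by rw [(hH' y).deriv]; positivity
  have hH0 : 0 ≤ H 0 := by
    rw [hH]
    simp only [zero_mul, zero_add]
    positivity
  have hHs : H s = 0 := by rw [hH]; simp [h0, h1]
  have hzero : ∀ y, 0 < y → y < s → besselSeries y = 0 := fun y hy hys => by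
    have h2 : H y ≤ 0 := hHs ▸ hmono hys.le
    have h3 : 0 ≤ besselTheta y ^ 2 := sq_nonneg _
    have h4 : y * besselSeries y ^ 2 ≤ 0 := by
      have : H y = y * besselSeries y ^ 2 + besselTheta y ^ 2 := rfl
      linarith
    have h5 := nonpos_of_mul_nonpos_right h4 hy
    exact pow_eq_zero_iff two_ne_zero |>.1 (le_antisymm h5 (sq_nonneg _))
  have hev : ∀ᶠ y in 𝓝[>] (0 : ℝ), besselSeries y ≠ 0 :=
    nhdsWithin_le_nhds ((hg 0).continuousAt.eventually_ne (by rw [besselSeries_zero]; simp))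
  obtain ⟨y, hy1, hy2⟩ := (hev.and (Ioo_mem_nhdsGT hs)).exists
  exact hy1 (hzero y hy2.1 hy2.2)

/-! ### Identifying the factors with the zeros; power sums -/

section Product

variable {a : ℕ → ℝ}

theorem besselSeries_eq_zero_iff_of_tprod (hsum : Summable a)
    (hprod : ∀ s, besselSeries s = ∏' k, (1 + -(s * a k))) (s : ℝ) :
    besselSeries s = 0 ↔ ∃ k, s * a k = 1 := by
  rw [hprod]
  constructor
  · intro h
    by_contra! hne
    refine tprod_one_add_ne_zero_of_summable (f := fun k => -(s * a k)) (fun k hk => ?_) ?_ h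
    · exact hne k (by linarith)
    · simpa using (hsum.mul_left s).norm
  · rintro ⟨k, hk⟩
    exact tprod_of_exists_eq_zero ⟨k, by rw [hk]; ring⟩

/-- If a_K = 0, the product has at most K nontrivial factors, so G(-y) = O(y^K), contradicting G(-y)
≥ y^(K+1)/(K+1)!² for large y. -/
theorem pos_of_besselSeries_eq_tprod (hanti : Antitone a) (ha0 : ∀ k, 0 ≤ a k)
    (hprod : ∀ s, besselSeries s = ∏' k, (1 + -(s * a k))) (K : ℕ) : 0 < a K := by
  by_contra hK
  have hzero : ∀ k, K ≤ k → a k = 0 := fun k hk =>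
    le_antisymm ((hanti hk).trans (not_lt.1 hK)) (ha0 k)
  have hF : (0 : ℝ) < ((K + 1).factorial : ℝ) ^ 2 := by positivity
  set y : ℝ := ((K + 1).factorial : ℝ) ^ 2 * (1 + a 0) ^ K + 1 with hy
  have ha := ha0 0
  have hy1 : 1 ≤ y := by
    have : 0 ≤ ((K + 1).factorial : ℝ) ^ 2 * (1 + a 0) ^ K := by positivity
    linarith
  have h1 : y ^ (K + 1) / ((K + 1).factorial : ℝ) ^ 2 ≤ besselSeries (-y) := by
    have := (summable_besselSeries (-y)).le_tsum (K + 1) fun k _ => by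
      rw [neg_neg]; positivity
    simpa [besselSeries] using this
  have h2 : besselSeries (-y) ≤ ((1 + a 0) * y) ^ K := by
    rw [hprod, tprod_eq_prod (s := range K) fun k hk => by
      rw [hzero k (by simpa using hk)]; simp]
    calc ∏ k ∈ range K, (1 + -(-y * a k)) ≤ ∏ k ∈ range K, ((1 + a 0) * y) := by
          refine Finset.prod_le_prod (fun k _ => ?_) fun k _ => ?_
          · have := mul_nonneg (by linarith : 0 ≤ y) (ha0 k)
            linarith
          · have := mul_le_mul_of_nonneg_left (hanti (Nat.zero_le k)) (by linarith : 0 ≤ y)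
            linarith
      _ = _ := by simp
  have h3 := h1.trans h2
  rw [div_le_iff₀ hF, mul_pow, pow_succ'] at h3
  have h4 : y ≤ ((K + 1).factorial : ℝ) ^ 2 * (1 + a 0) ^ K := by
    refine le_of_mul_le_mul_right ?_ (by positivity : 0 < y ^ K)
    linarith
  linarith

theorem abs_besselSeries_le_of_tprod (hsum : Summable a) (ha0 : ∀ k, 0 ≤ a k)
    (hprod : ∀ s, besselSeries s = ∏' k, (1 + -(s * a k))) {i j : ℕ} (hij : i ≠ j) (s : ℝ) :
    |besselSeries s| ≤ |1 - s * a i| * |1 - s * a j| * Real.exp (|s| * ∑' k, a k) := by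
  have hm : Multipliable fun k => 1 + -(s * a k) :=
    multipliable_one_add_of_summable (by simpa using (hsum.mul_left s).norm)
  have hlim : Tendsto (fun S : Finset ℕ => |∏ k ∈ S, (1 + -(s * a k))|) atTop
      (𝓝 |besselSeries s|) := by
    rw [hprod]
    exact (continuous_abs.tendsto _).comp hm.hasProd
  refine le_of_tendsto hlim ?_
  filter_upwards [eventually_ge_atTop {i, j}] with S hS
  have hi : i ∈ S := hS (by simp)
  have hj : j ∈ S.erase i := mem_erase.2 ⟨hij.symm, hS (by simp)⟩
  rw [← mul_prod_erase S _ hi, ← mul_prod_erase _ _ hj, abs_mul, abs_mul, ← sub_eq_add_neg,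
    ← sub_eq_add_neg, ← mul_assoc]
  gcongr
  calc |∏ k ∈ (S.erase i).erase j, (1 + -(s * a k))|
      ≤ ∏ k ∈ (S.erase i).erase j, Real.exp (|s| * a k) := by
        rw [abs_prod]
        refine Finset.prod_le_prod (fun _ _ => abs_nonneg _) fun k _ => ?_
        have h1 := abs_add_le 1 (-(s * a k))
        rw [abs_one, abs_neg, abs_mul, abs_of_nonneg (ha0 k)] at h1
        linarith [Real.add_one_le_exp (|s| * a k)]
    _ = Real.exp (|s| * ∑ k ∈ (S.erase i).erase j, a k) := by rw [← Real.exp_sum, mul_sum]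
    _ ≤ Real.exp (|s| * ∑' k, a k) := by
        gcongr
        exact hsum.sum_le_tsum _ fun k _ => ha0 k

/-- If aᵢ = aⱼ, pulling both factors out gives G = O((s - s₀)²) at s₀ = 1/aᵢ, so G'(s₀) = 0 at a
zero, which simplicity forbids. -/
theorem strictAnti_of_besselSeries_eq_tprod (hanti : Antitone a) (hsum : Summable a)
    (ha0 : ∀ k, 0 ≤ a k) (hprod : ∀ s, besselSeries s = ∏' k, (1 + -(s * a k))) :
    StrictAnti a := by
  refine hanti.strictAnti_of_injective fun i j hij => ?_
  by_contra hne
  have hpos := pos_of_besselSeries_eq_tprod hanti ha0 hprod i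
  set s₀ := 1 / a i with hs₀
  have hs₀' : s₀ * a i = 1 := by rw [hs₀]; field_simp
  obtain ⟨g, hg, hgθ⟩ := exists_hasDerivAt_besselSeries s₀
  have hO : besselSeries =O[𝓝 s₀] fun s => ‖s - s₀‖ ^ 2 := by
    refine Asymptotics.IsBigO.of_bound (a i ^ 2 * Real.exp ((|s₀| + 1) * ∑' k, a k)) ?_
    have hev : ∀ᶠ s in 𝓝 s₀, |s| ≤ |s₀| + 1 :=
      (continuous_abs.tendsto s₀).eventually_le_const (by linarith)
    filter_upwards [hev] with s hs
    have hT : 0 ≤ ∑' k, a k := tsum_nonneg ha0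
    have h1 : |1 - s * a i| = a i * |s - s₀| := by
      rw [← hs₀', ← sub_mul, abs_mul, abs_of_pos hpos, abs_sub_comm, mul_comm]
    have h2 := abs_besselSeries_le_of_tprod hsum ha0 hprod hne s
    rw [← hij, h1] at h2
    rw [norm_pow, norm_norm, Real.norm_eq_abs, Real.norm_eq_abs]
    calc |besselSeries s| ≤ a i * |s - s₀| * (a i * |s - s₀|) * Real.exp (|s| * ∑' k, a k) := h2
      _ ≤ a i * |s - s₀| * (a i * |s - s₀|) * Real.exp ((|s₀| + 1) * ∑' k, a k) := by gcongr
      _ = _ := by ring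
  have hd : HasDerivAt besselSeries 0 s₀ := by
    simpa using (hO.hasFDerivAt one_lt_two).hasDerivAt
  refine besselTheta_ne_zero (s := s₀) (by positivity)
    ((besselSeries_eq_zero_iff_of_tprod hsum hprod s₀).2 ⟨i, hs₀'⟩) ?_
  rw [← hgθ, hg.unique hd, mul_zero]

theorem isBesselZeroSeq_of_besselSeries_eq_tprod (hanti : Antitone a) (hsum : Summable a)
    (ha0 : ∀ k, 0 ≤ a k) (hprod : ∀ s, besselSeries s = ∏' k, (1 + -(s * a k))) :
    IsBesselZeroSeq fun k => 2 / √(a k) := by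
  have hpos := pos_of_besselSeries_eq_tprod hanti ha0 hprod
  have hstrict := strictAnti_of_besselSeries_eq_tprod hanti hsum ha0 hprod
  refine ⟨fun i j hij => ?_, ?_⟩
  · have h1 := Real.sqrt_pos.2 (hpos j)
    have h2 := Real.sqrt_lt_sqrt (ha0 j) (hstrict hij)
    exact div_lt_div_of_pos_left two_pos h1 h2
  · ext x
    simp only [Set.mem_range, Set.mem_ofPred_eq, besselJZero_eq_zero_iff,
      besselSeries_eq_zero_iff_of_tprod hsum hprod]
    constructor
    · rintro ⟨k, rfl⟩
      have h1 := Real.sqrt_pos.2 (hpos k)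
      refine ⟨by positivity, k, ?_⟩
      have h2 := (hpos k).ne'
      rw [div_pow, Real.sq_sqrt (ha0 k)]
      field_simp
      norm_num
    · rintro ⟨hx, k, hk⟩
      have h1 := Real.sqrt_pos.2 (hpos k)
      refine ⟨k, ?_⟩
      rw [div_eq_iff h1.ne']
      refine (pow_left_inj₀ two_pos.le (by positivity) two_ne_zero).1 ?_
      rw [mul_pow, Real.sq_sqrt (ha0 k)]
      linarith

theorem summable_pow_of_summable (hsum : Summable a) (ha0 : ∀ k, 0 ≤ a k) (n : ℕ) (hn : 1 ≤ n) :
    Summable fun k => a k ^ n := by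
  have h1 : ∀ᶠ k in cofinite, a k ≤ 1 := hsum.tendsto_cofinite_zero.eventually_le_const one_pos
  refine Summable.of_norm_bounded_eventually hsum ?_
  filter_upwards [h1] with k hk
  rw [Real.norm_of_nonneg (pow_nonneg (ha0 k) n)]
  exact pow_le_of_le_one (ha0 k) hk (by omega)

theorem hasSum_pow_div_neg_log {x : ℝ} (hx : |x| < 1) :
    HasSum (fun n : ℕ => x ^ n / n) (-Real.log (1 - x)) := by
  have := Real.hasSum_pow_div_log_of_abs_lt_one hx
  rw [← hasSum_nat_add_iff' 1]
  simpa using this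

/-- `-log G(s) = ∑ Pₙ sⁿ / n` with the power sums `Pₙ = ∑ aₖⁿ`, if `G(s) = ∏ (1 - s aₖ)`. -/
theorem hasSum_powerSum_of_tprod (hanti : Antitone a) (hsum : Summable a)
    (ha0 : ∀ k, 0 ≤ a k) (hprod : ∀ s, besselSeries s = ∏' k, (1 + -(s * a k))) {s : ℝ}
    (hs0 : 0 < s) (hs : s * a 0 < 1) :
    0 < besselSeries s ∧
      HasSum (fun n : ℕ => -(∑' k, a k ^ n) / n * s ^ n) (Real.log (besselSeries s)) := by
  have hlt : ∀ k, s * a k < 1 := fun k =>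
    (mul_le_mul_of_nonneg_left (hanti (Nat.zero_le k)) hs0.le).trans_lt hs
  have hnn : ∀ k, 0 ≤ s * a k := fun k => mul_nonneg hs0.le (ha0 k)
  have hlog : Summable fun k => Real.log (1 + -(s * a k)) :=
    Real.summable_log_one_add_of_summable (hsum.mul_left s).neg
  have hG : besselSeries s = Real.exp (∑' k, Real.log (1 + -(s * a k))) := by
    rw [hprod, Real.rexp_tsum_eq_tprod (fun k => by linarith [hlt k]) hlog]
  have hrow : ∀ k, HasSum (fun n : ℕ => (s * a k) ^ n / n) (-Real.log (1 + -(s * a k))) := fun k => by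
    rw [← sub_eq_add_neg]
    exact hasSum_pow_div_neg_log (by rw [abs_of_nonneg (hnn k)]; exact hlt k)
  have hS : Summable fun p : ℕ × ℕ => (s * a p.1) ^ p.2 / (p.2 : ℝ) := by
    refine (summable_prod_of_nonneg fun p => ?_).2 ⟨fun k => (hrow k).summable, ?_⟩
    · have := hnn p.1
      positivity
    · exact hlog.neg.congr fun k => ((hrow k).tsum_eq).symm
  have hcol : HasSum (fun n : ℕ => ∑' k, (s * a k) ^ n / (n : ℝ))
      (∑' k, -Real.log (1 + -(s * a k))) := by
    have h1 := hS.prod_symm.prod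
    have h2 : ∑' (n : ℕ) (k : ℕ), (s * a k) ^ n / (n : ℝ) = ∑' k, -Real.log (1 + -(s * a k)) := by
      rw [Summable.tsum_comm (f := fun (k n : ℕ) => (s * a k) ^ n / (n : ℝ)) hS]
      exact tsum_congr fun k => (hrow k).tsum_eq
    exact h2 ▸ h1.hasSum
  refine ⟨hG ▸ Real.exp_pos _, ?_⟩
  rw [hG, Real.log_exp]
  have h := hcol.neg
  rw [tsum_neg, neg_neg] at h
  refine (congrArg (HasSum · _) (funext fun n => ?_)).mp h
  rw [tsum_div_const]
  simp_rw [mul_pow]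
  rw [tsum_mul_left]
  ring

end Product

/-- The right-hand side `-t` of the Riccati equation for `J₀`. -/
noncomputable def besselRiccati (n : ℕ) : ℝ := if n = 1 then -1 else 0

theorem sq_mul_besselCoeff_eq_sum_antidiagonal (n : ℕ) :
    (n : ℝ) ^ 2 * besselCoeff n = ∑ ij ∈ antidiagonal n, besselRiccati ij.1 * besselCoeff ij.2 := by
  cases n with
  | zero => simp [besselRiccati]
  | succ n =>
    rw [succ_sq_mul_besselCoeff_succ, Finset.Nat.sum_antidiagonal_succ,
      Finset.Nat.sum_antidiagonal_eq_sum_range_succ_mk, sum_range_succ', Finset.sum_eq_zero]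
    · simp [besselRiccati]
    · intro k _
      simp [besselRiccati]

/-- Both sides, divided by n, are the coefficients of log G near 0. -/
theorem riccatiCoeff_besselRiccati {a : ℕ → ℝ} (hanti : Antitone a) (hsum : Summable a)
    (ha0 : ∀ k, 0 ≤ a k) (hprod : ∀ s, besselSeries s = ∏' k, (1 + -(s * a k))) {n : ℕ}
    (hn : n ≠ 0) : riccatiCoeff besselRiccati n = -∑' k, a k ^ n := by
  have ha := ha0 0
  have hε : 0 < 1 / (1 + a 0) := by positivity
  have h := eq_of_hasSum_mul_pow (f := fun n => riccatiCoeff besselRiccati n / n)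
    (g := fun n => -(∑' k, a k ^ n) / n) hε fun t ht0 ht1 => by
      rw [lt_div_iff₀ (by positivity)] at ht1
      have := mul_nonneg ht0.le ha
      obtain ⟨hpos, hlog⟩ := hasSum_powerSum_of_tprod hanti hsum ha0 hprod ht0 (by linarith)
      refine ⟨_, ?_, hlog⟩
      obtain ⟨h1, h2⟩ := hasSum_exp_riccatiCoeff (d := besselRiccati) (c := besselCoeff) (m := 1)
        one_pos (by simp [besselRiccati])
        (fun n => by rw [besselRiccati]; split_ifs <;> simp) (by simp [besselCoeff])
        sq_mul_besselCoeff_eq_sum_antidiagonal ht0.le (by linarith)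
      rw [besselSeries_eq_tsum, h2.tsum_eq, Real.log_exp]
      exact h1.hasSum
  have hn' : (n : ℝ) ≠ 0 := by exact_mod_cast hn
  exact (div_left_inj' hn').1 (congrFun h n)

end BesselZeros

/-! ### Logarithm of the integral and top coefficients -/

section LogExpansion

open Polynomial in
/-- The polynomials `pₙ(x)` with `log I(b, 2x) = ∑ pₙ(x) / (n b²ⁿ)`. -/
noncomputable def logPoly : ℕ → ℝ[X] :=
  riccatiCoeff fun n => if n = 0 then 0 else -X ^ 2

theorem eval_logPoly (x : ℝ) (n : ℕ) :
    (logPoly n).eval x = riccatiCoeff (fun n => if n = 0 then 0 else -x ^ 2) n := by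
  have := riccatiCoeff_map (Polynomial.aeval x : Polynomial ℝ →ₐ[ℝ] ℝ)
    (fun n => if n = 0 then 0 else -Polynomial.X ^ 2) n
  rw [Polynomial.coe_aeval_eq_eval] at this
  rw [logPoly, this]
  congr 1
  funext k
  split_ifs <;> simp

theorem hasSum_log_charI {b x : ℝ} (hb : max 1 |x| < b) :
    charI b (2 * x) ≠ 0 ∧
      ∃ L : ℝ, Complex.log (charI b (2 * x)) = L ∧
        HasSum (fun n : ℕ => (logPoly n).eval x / n * ((b ^ 2)⁻¹) ^ n) L := by
  have hb1 : 1 < b := (le_max_left _ _).trans_lt hb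
  have hbx : |x| < b := (le_max_right _ _).trans_lt hb
  have hb0 : 0 < b := by linarith
  have hm1 : 1 ≤ max 1 (x ^ 2) := le_max_left _ _
  -- With m = max(1, x²) and t = b⁻², the condition m t < 1 is exactly b > max(1, |x|).
  obtain ⟨h1, h2⟩ := hasSum_exp_riccatiCoeff (d := fun n => if n = 0 then 0 else -x ^ 2)
    (c := hyperCoeff x) (m := max 1 (x ^ 2)) (t := (b ^ 2)⁻¹) (by positivity) (by simp)
    (fun n => by
      rcases Nat.eq_zero_or_pos n with rfl | hn
      · simp
      · rw [if_neg hn.ne', abs_neg, abs_of_nonneg (by positivity)]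
        exact (le_max_right _ _).trans (le_self_pow₀ hm1 hn.ne'))
    (by simp [hyperCoeff]) (sq_mul_hyperCoeff_eq_sum_antidiagonal x) (by positivity) (by
      rw [mul_inv_lt_iff₀ (by positivity), one_mul, max_lt_iff]
      exact ⟨by nlinarith, by rw [sq_lt_sq, abs_of_pos hb0]; exact hbx⟩)
  simp_rw [← eval_logPoly] at h1 h2
  have h3 : charI b (2 * x) =
      (Real.exp (∑' n : ℕ, (logPoly n).eval x / n * ((b ^ 2)⁻¹) ^ n) : ℂ) := by
    exact (hasSum_charI hb1 x).unique (Complex.hasSum_ofReal.2 h2)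
  refine ⟨by rw [h3]; exact_mod_cast (Real.exp_pos _).ne', _, ?_, h1.hasSum⟩
  rw [h3, ← Complex.ofReal_log (Real.exp_pos _).le, Real.log_exp]

theorem isLogExpansion_iff (Q : ℕ+ → Polynomial ℝ) :
    IsLogExpansion Q ↔ ∀ n : ℕ+, Q n =
      Polynomial.C (-((Nat.factorial n : ℝ) * Nat.factorial ((n : ℕ) - 1))) * logPoly n := by
  have hfac : ∀ n : ℕ+, (Nat.factorial n : ℝ) = n * Nat.factorial ((n : ℕ) - 1) := fun n => by
    exact_mod_cast (Nat.mul_factorial_pred n.ne_zero).symm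
  constructor
  · intro hQ
    suffices h : ∀ (n : ℕ+) (x : ℝ),
        -((Q n).eval x / (Nat.factorial n : ℝ) ^ 2) = (logPoly n).eval x / n by
      intro n
      refine Polynomial.funext fun x => ?_
      have h1 := h n x
      have h2 : (Nat.factorial ((n : ℕ) - 1) : ℝ) ≠ 0 := by positivity
      have h3 : ((n : ℕ) : ℝ) ≠ 0 := by exact_mod_cast n.ne_zero
      rw [hfac] at h1
      rw [Polynomial.eval_mul, Polynomial.eval_C, hfac]
      field_simp at h1
      linear_combination -h1
    intro n x
    -- The value f 0 = 0 extends the family from ℕ+ to ℕ, matching the zero constant term of the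
    -- logarithm.
    set f : ℕ → ℝ := fun k => if h : 0 < k then
      -((Q ⟨k, h⟩).eval x / (Nat.factorial k : ℝ) ^ 2) else 0 with hf
    have hfg : f = fun k => (logPoly k).eval x / k := by
      refine eq_of_hasSum_mul_pow (ε := 1 / (max 1 |x|) ^ 2) (by positivity) fun t ht0 ht1 => ?_
      have hst := Real.sqrt_pos.2 ht0
      have hb : max 1 |x| < 1 / √t := by
        rw [lt_div_iff₀ (by positivity), ← Real.sqrt_sq (by positivity : 0 ≤ max 1 |x|),
          ← Real.sqrt_mul (by positivity), Real.sqrt_lt' one_pos]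
        rw [lt_div_iff₀ (by positivity)] at ht1
        linarith
      have hbt : ((1 / √t) ^ 2)⁻¹ = t := by
        rw [one_div, inv_pow, inv_inv, Real.sq_sqrt ht0.le]
      obtain ⟨-, L, hL, hsum⟩ := hasSum_log_charI hb
      rw [hbt] at hsum
      refine ⟨L, ?_, hsum⟩
      have h := (hQ _ x hb).2
      rw [hL] at h
      rw [show L = L + f 0 * t ^ 0 by simp [hf], ← hasSum_pnat_iff (f := fun n => f n * t ^ n)]
      refine Complex.hasSum_ofReal.1 ((congrArg (HasSum · _) (funext fun n => ?_)).mp h)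
      have hf' : f n = -((Q n).eval x / (Nat.factorial n : ℝ) ^ 2) := dif_pos n.pos
      rw [← Complex.ofReal_neg, hf', pow_mul,
        inv_eq_iff_eq_inv.1 hbt, inv_pow]
      congr 1
      field_simp
    have h := congrFun hfg n
    simp only [hf, n.pos, dif_pos] at h
    exact h
  · intro hQ b x hb
    obtain ⟨h0, L, hL, hsum⟩ := hasSum_log_charI hb
    refine ⟨h0, ?_⟩
    rw [hL]
    rw [show L = L + (logPoly 0).eval x / (0 : ℕ) * ((b ^ 2)⁻¹) ^ 0 by simp, ← hasSum_pnat_iff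
      (f := fun n : ℕ => (logPoly n).eval x / n * ((b ^ 2)⁻¹) ^ n)] at hsum
    refine (congrArg (HasSum · _) (funext fun n => ?_)).mp (Complex.hasSum_ofReal.2 hsum)
    have h2 : (Nat.factorial ((n : ℕ) - 1) : ℝ) ≠ 0 := by positivity
    have h3 : ((n : ℕ) : ℝ) ≠ 0 := by exact_mod_cast n.ne_zero
    rw [← Complex.ofReal_neg, hQ, Polynomial.eval_mul, Polynomial.eval_C, hfac, inv_pow, ← pow_mul]
    congr 1
    field_simp

/-- Products in the recursion have degree at most 2(n + 1), so their top coefficients multiply; the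
inhomogeneity -x² reaches degree 2k only at k = 1, leaving the right-hand side -t. -/
theorem natDegree_coeff_logPoly (n : ℕ) :
    (logPoly n).natDegree ≤ 2 * n ∧ (logPoly n).coeff (2 * n) = riccatiCoeff besselRiccati n := by
  induction n using Nat.strong_induction_on with
  | _ n ih =>
    cases n with
    | zero => simp [logPoly]
    | succ n =>
      have e : logPoly (n + 1) = ((n + 1 : ℝ)⁻¹) • (-Polynomial.X ^ 2 -
          ∑ i ∈ range n, logPoly (i + 1) * logPoly (n - i)) := by
        rw [logPoly, riccatiCoeff_succ, if_neg n.succ_ne_zero]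
      have hidx : ∀ i ∈ range n, 2 * (n + 1) = 2 * (i + 1) + 2 * (n - i) := fun i hi => by
        have := mem_range.1 hi
        omega
      rw [e]
      constructor
      · refine (Polynomial.natDegree_smul_le _ _).trans
          ((Polynomial.natDegree_sub_le _ _).trans (max_le ?_ ?_))
        · rw [Polynomial.natDegree_neg, Polynomial.natDegree_X_pow]
          omega
        · refine Polynomial.natDegree_sum_le_of_forall_le _ _ fun i hi => ?_
          have := mem_range.1 hi
          rw [hidx i hi]
          exact Polynomial.natDegree_mul_le_of_le (ih _ (by omega)).1 (ih _ (by omega)).1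
      · rw [Polynomial.coeff_smul, Polynomial.coeff_sub, Polynomial.finsetSum_coeff,
          riccatiCoeff_succ]
        congr 2
        · rw [Polynomial.coeff_neg, Polynomial.coeff_X_pow, besselRiccati]
          rcases Nat.eq_zero_or_pos n with rfl | hn
          · simp
          · rw [if_neg (by omega), if_neg (by omega), neg_zero]
        · refine Finset.sum_congr rfl fun i hi => ?_
          have := mem_range.1 hi
          rw [hidx i hi, Polynomial.coeff_mul_add_eq_of_natDegree_le (ih _ (by omega)).1
            (ih _ (by omega)).1, (ih _ (by omega)).2, (ih _ (by omega)).2]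

end LogExpansion

theorem mainTheorem7 :
    (∃! Q : ℕ+ → Polynomial ℝ, IsLogExpansion Q) ∧
    (∃! j : ℕ → ℝ, IsBesselZeroSeq j) ∧
    ∀ (Q : ℕ+ → Polynomial ℝ) (j : ℕ → ℝ), IsLogExpansion Q → IsBesselZeroSeq j →
      ∀ n : ℕ+,
        Summable (fun k : ℕ => 1 / j k ^ (2 * (n : ℕ))) ∧
        (Q n).coeff (2 * (n : ℕ)) =
          2 ^ (2 * (n : ℕ)) * (Nat.factorial n : ℝ) * (Nat.factorial ((n : ℕ) - 1) : ℝ) *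
            ∑' k : ℕ, 1 / j k ^ (2 * (n : ℕ)) := by
  obtain ⟨a, hanti, ha0, hsum, hprod⟩ := exists_besselSeries_eq_tprod
  have hj := isBesselZeroSeq_of_besselSeries_eq_tprod hanti hsum ha0 hprod
  have huniq : ∀ j, IsBesselZeroSeq j → j = fun k => 2 / √(a k) := fun j hj' =>
    (StrictMono.range_inj hj'.1 hj.1).1 (hj'.2.trans hj.2.symm)
  refine ⟨⟨fun n => Polynomial.C (-((Nat.factorial n : ℝ) * Nat.factorial ((n : ℕ) - 1))) *
      logPoly n, (isLogExpansion_iff _).2 fun n => rfl,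
      fun Q hQ => funext ((isLogExpansion_iff Q).1 hQ)⟩, ⟨_, hj, huniq⟩, fun Q j hQ hj' n => ?_⟩
  have hterm : ∀ k, 1 / j k ^ (2 * (n : ℕ)) = a k ^ (n : ℕ) / 2 ^ (2 * (n : ℕ)) := fun k => by
    rw [huniq j hj', div_pow, pow_mul √(a k), Real.sq_sqrt (ha0 k), one_div_div]
  simp_rw [hterm]
  refine ⟨(summable_pow_of_summable hsum ha0 n n.pos).div_const _, ?_⟩
  rw [tsum_div_const, (isLogExpansion_iff Q).1 hQ n, Polynomial.coeff_C_mul,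
    (natDegree_coeff_logPoly n).2, riccatiCoeff_besselRiccati hanti hsum ha0 hprod n.ne_zero]
  field_simp
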